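/- Let $I=[0,1]$ and let $W:I^2\to[-1,1]$ be a symmetric measurable function (a signed graphon) that is piecewise Lipschitz: there are a finite partition $0=\alpha_0<\alpha_1<\dots<\alpha_{K+1}=1$ and a constant $L$ such that for all $k,l\in\{1,\dots,K+1\}$ and all $(x,y),(x',y')\in(\alpha_{k-1},\alpha_k)\times(\alpha_{l-1},\alpha_l)$ one has $|W(x,y)-W(x',y')|\le L(|x-x'|+|y-y'|)$. For every $n$ let $X_1,\dots,X_n\in I$ (depending on $n$) be latent variables of one of the following two types, the same type for all $n$: deterministic, $X_i=\frac in$; or stochastic, $X_i=U_{(i)}$, where $U_{(1)}\le\dots\le U_{(n)}$ are the order statistics of $n$ independent random variables $U_1,\dots,U_n$ with the uniform distribution on $I$. Let $A^{(n)}$ be a random symmetric $n\times n$ matrix with entries in $\{-1,0,1\}$ such that $A^{(n)}_{ij}=\operatorname{sign}(W(X_i,X_j))\,\eta_{ij}$ for $i<j$, where, conditionally on $(X_1,\dots,X_n)$, the variables $\eta_{ij}$, $i<j$, are independent Bernoulli variables with parameters $|W(X_i,X_j)|$. All these random variables, for all $n$, live on one probability space; nothing is assumed on their joint distribution for different $n$,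 nor on the diagonal of $A^{(n)}$. Let $W_n(x,y)=\sum_{i,j=1}^n A^{(n)}_{ij}\,\mathbf 1_{I_i}(x)\,\mathbf 1_{I_j}(y)$ with $I_i=\left(\frac{i-1}n,\frac in\right]$ be the signed graphon associated with the sampled graph. For a signed graphon $V$ write $V^+=\max(V,0)$, $V^-=\max(-V,0)$, let $T_V:L^2(I)\to L^2(I)$ be the operator $(T_Vf)(x)=\int_0^1V(x,y)f(y)\,dy$, and let $|||\cdot|||$ be the operator norm on $L^2(I)$. Then, almost surely, as $n\to\infty$, $$|||T_{W_n}-T_W|||\to0,\qquad |||T_{W_n^+}-T_{W^+}|||\to0,\qquad |||T_{W_n^-}-T_{W^-}|||\to0 .$$ -/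

import Mathlib

open MeasureTheory ProbabilityTheory Filter Topology unitInterval

/-- A (signed) graphon: a symmetric measurable function `[0,1]² → [-1,1]`. -/
structure SignedGraphon where
  toFun : I → I → ℝ
  measurable' : Measurable (Function.uncurry toFun)
  symm' : ∀ x y, toFun x y = toFun y x
  abs_le_one' : ∀ x y, |toFun x y| ≤ 1

namespace SignedGraphon

instance : CoeFun SignedGraphon (fun _ => I → I → ℝ) := ⟨SignedGraphon.toFun⟩

/-- The positive part `W⁺ = max(W, 0)`. -/
def posPart (W : SignedGraphon) : SignedGraphon where
  toFun x y := max (W x y) 0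
  measurable' := W.measurable'.max measurable_const
  symm' x y := by rw [W.symm' x y]
  abs_le_one' x y := by
    have h := abs_le.1 (W.abs_le_one' x y)
    rw [abs_of_nonneg (le_max_right _ _)]
    exact max_le h.2 zero_le_one

/-- The negative part `W⁻ = max(-W, 0)`. -/
def negPart (W : SignedGraphon) : SignedGraphon where
  toFun x y := max (-W x y) 0
  measurable' := W.measurable'.neg.max measurable_const
  symm' x y := by rw [W.symm' x y]
  abs_le_one' x y := by
    have h := abs_le.1 (W.abs_le_one' x y)
    rw [abs_of_nonneg (le_max_right _ _)]
    exact max_le (by linarith [h.1]) zero_le_one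

/-- The real Hilbert space `L²[0,1]`. -/
abbrev L2 : Type := Lp ℝ 2 (volume : Measure I)

theorem integrable_L2 (f : L2) : Integrable (f : I → ℝ) volume :=
  (Lp.memLp f).integrable (by norm_num)

theorem measurable_section (W : SignedGraphon) (x : I) : Measurable (W x) :=
  W.measurable'.comp measurable_prodMk_left

theorem integrable_mul (W : SignedGraphon) (f : L2) (x : I) :
    Integrable (fun y => W x y * f y) volume :=
  (integrable_L2 f).bdd_mul (c := 1) (W.measurable_section x).aestronglyMeasurable
    (ae_of_all _ fun y => by simpa using W.abs_le_one' x y)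

theorem integral_abs_le_norm (f : L2) : ∫ y, |f y| ≤ ‖f‖ := by
  have h1 : ∫ y, |f y| = (eLpNorm f 1 volume).toReal := by
    rw [eLpNorm_one_eq_lintegral_enorm, ← integral_norm_eq_lintegral_enorm
      (Lp.aestronglyMeasurable f)]
    rfl
  rw [h1, Lp.norm_def]
  exact ENNReal.toReal_mono (Lp.eLpNorm_ne_top f)
    (eLpNorm_le_eLpNorm_of_exponent_le (by norm_num) (Lp.aestronglyMeasurable f))

theorem abs_integral_le (W : SignedGraphon) (f : L2) (x : I) :
    ‖∫ y, W x y * f y‖ ≤ ‖f‖ := by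
  refine le_trans (norm_integral_le_integral_norm _) (le_trans ?_ (integral_abs_le_norm f))
  refine integral_mono (W.integrable_mul f x).norm (integrable_L2 f).abs fun y => ?_
  have := W.abs_le_one' x y
  simp only [norm_mul, Real.norm_eq_abs]
  exact mul_le_of_le_one_left (abs_nonneg _) this

theorem memLp_integral (W : SignedGraphon) (f : L2) :
    MemLp (fun x => ∫ y, W x y * f y) 2 (volume : Measure I) := by
  refine MemLp.of_bound ?_ ‖f‖ (ae_of_all _ (W.abs_integral_le f))
  have h : StronglyMeasurable (fun p : I × I => W p.1 p.2 * f p.2) :=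
    W.measurable'.stronglyMeasurable.mul
      ((Lp.stronglyMeasurable f).comp_measurable measurable_snd)
  exact h.integral_prod_right.aestronglyMeasurable

/-- The integral operator `T_W : L²[0,1] → L²[0,1]`, `(T_W f)(x) = ∫₀¹ W(x,y) f(y) dy`, as a
bounded operator; the norm of `L2 →L[ℝ] L2` is the operator norm. -/
noncomputable def T (W : SignedGraphon) : L2 →L[ℝ] L2 :=
  LinearMap.mkContinuous
    { toFun := fun f => (W.memLp_integral f).toLp (fun x => ∫ y, W x y * f y)
      map_add' := fun f g => by
        rw [← MemLp.toLp_add]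
        refine MemLp.toLp_congr _ _ (ae_of_all _ fun x => ?_)
        simp only [Pi.add_apply]
        rw [← integral_add (W.integrable_mul f x) (W.integrable_mul g x)]
        refine integral_congr_ae ?_
        filter_upwards [Lp.coeFn_add f g] with y hy
        rw [hy, Pi.add_apply, mul_add]
      map_smul' := fun c f => by
        rw [RingHom.id_apply, ← MemLp.toLp_const_smul]
        refine MemLp.toLp_congr _ _ (ae_of_all _ fun x => ?_)
        simp only [Pi.smul_apply, smul_eq_mul]
        rw [← integral_const_mul]
        refine integral_congr_ae ?_
        filter_upwards [Lp.coeFn_smul c f] with y hy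
        rw [hy, Pi.smul_apply, smul_eq_mul]
        ring }
    1 fun f => by
      rw [one_mul]
      refine (Lp.norm_le_of_ae_bound (C := ‖f‖) (norm_nonneg f) ?_).trans_eq (by
        simp [measureUnivNNReal])
      filter_upwards [MemLp.coeFn_toLp (W.memLp_integral f)] with x hx
      exact (congrArg norm hx).trans_le (W.abs_integral_le f x)

/-- Piecewise Lipschitz: for some finite partition `0 = α₀ < α₁ < ⋯ < α_{K+1} = 1` and some `L`,
`|W(x,y) - W(x',y')| ≤ L (|x - x'| + |y - y'|)` whenever `(x,y)` and `(x',y')` lie in the same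
rectangle of the grid. The rectangles are taken open, so nothing is asked on the grid lines and it
does not matter to which piece the breakpoints are attached. -/
def IsPiecewiseLipschitz (W : SignedGraphon) : Prop :=
  ∃ (K : ℕ) (α : Fin (K + 2) → ℝ) (L : ℝ),
    StrictMono α ∧ α 0 = 0 ∧ α (Fin.last (K + 1)) = 1 ∧
    ∀ (k l : Fin (K + 1)) (x x' y y' : I),
      (x : ℝ) ∈ Set.Ioo (α k.castSucc) (α k.succ) → (x' : ℝ) ∈ Set.Ioo (α k.castSucc) (α k.succ) →
      (y : ℝ) ∈ Set.Ioo (α l.castSucc) (α l.succ) → (y' : ℝ) ∈ Set.Ioo (α l.castSucc) (α l.succ) →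
      |W x y - W x' y'| ≤ L * (|(x : ℝ) - x'| + |(y : ℝ) - y'|)

/-- The number `|W(x,y)|` as an element of `[0,1]`. -/
def edgeProb (W : SignedGraphon) (x y : I) : I :=
  ⟨|W x y|, abs_nonneg _, W.abs_le_one' x y⟩

end SignedGraphon

/-- A signed graph on `n` nodes: a symmetric adjacency matrix with entries in `{-1, 0, 1}`. -/
structure SignedGraph (n : ℕ) where
  adj : Fin n → Fin n → ℝ
  symm' : ∀ i j, adj i j = adj j i
  entries' : ∀ i j, adj i j = -1 ∨ adj i j = 0 ∨ adj i j = 1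

namespace SignedGraph

/-- The interval `I_i = ((i-1)/n, i/n]`, `i = 1, …, n` (nodes are numbered from `0` here). -/
def cell (n : ℕ) (i : Fin n) : Set I :=
  {x | ((i : ℕ) : ℝ) / n < x ∧ (x : ℝ) ≤ (((i : ℕ) : ℝ) + 1) / n}

theorem measurableSet_cell (n : ℕ) (i : Fin n) : MeasurableSet (cell n i) :=
  (measurableSet_lt measurable_const measurable_subtype_coe).inter
    (measurableSet_le measurable_subtype_coe measurable_const)

theorem cell_unique {n : ℕ} {i j : Fin n} {x : I} (hi : x ∈ cell n i) (hj : x ∈ cell n j) :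
    i = j := by
  have hn : (0 : ℝ) < n := by exact_mod_cast i.pos
  have h1 : ((i : ℕ) : ℝ) < (j : ℕ) + 1 := by
    have := lt_of_lt_of_le hi.1 hj.2
    rwa [div_lt_div_iff_of_pos_right hn] at this
  have h2 : ((j : ℕ) : ℝ) < (i : ℕ) + 1 := by
    have := lt_of_lt_of_le hj.1 hi.2
    rwa [div_lt_div_iff_of_pos_right hn] at this
  norm_cast at h1 h2
  ext
  omega

/-- `W_n(x,y) = ∑_{i,j} A_{ij} 1_{I_i}(x) 1_{I_j}(y)`. -/
noncomputable def stepFun {n : ℕ} (G : SignedGraph n) (x y : I) : ℝ :=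
  ∑ i, ∑ j, G.adj i j * (cell n i).indicator (fun _ => (1 : ℝ)) x
    * (cell n j).indicator (fun _ => (1 : ℝ)) y

theorem sum_indicator_mem {n : ℕ} (x : I) :
    ∑ i, (cell n i).indicator (fun _ => (1 : ℝ)) x ≤ 1 := by
  by_cases h : ∃ i, x ∈ cell n i
  · obtain ⟨i, hi⟩ := h
    rw [Finset.sum_eq_single i]
    · simp [hi]
    · intro j _ hj
      exact Set.indicator_of_notMem (fun h' => hj (cell_unique h' hi)) _
    · simp
  · push Not at h
    rw [Finset.sum_eq_zero fun i _ => Set.indicator_of_notMem (h i) _]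
    exact zero_le_one

theorem abs_stepFun_le {n : ℕ} (G : SignedGraph n) (x y : I) : |G.stepFun x y| ≤ 1 := by
  have h0 : ∀ (i : Fin n) (z : I), 0 ≤ (cell n i).indicator (fun _ => (1 : ℝ)) z := fun i z =>
    Set.indicator_nonneg (fun _ _ => zero_le_one) z
  have hA : ∀ i j, |G.adj i j| ≤ 1 := fun i j => by
    rcases G.entries' i j with h | h | h <;> simp [h]
  calc |G.stepFun x y|
      ≤ ∑ i, ∑ j, (cell n i).indicator (fun _ => (1 : ℝ)) x
          * (cell n j).indicator (fun _ => (1 : ℝ)) y := by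
        refine (Finset.abs_sum_le_sum_abs _ _).trans (Finset.sum_le_sum fun i _ => ?_)
        refine (Finset.abs_sum_le_sum_abs _ _).trans (Finset.sum_le_sum fun j _ => ?_)
        rw [abs_mul, abs_mul, abs_of_nonneg (h0 i x), abs_of_nonneg (h0 j y)]
        exact mul_le_mul_of_nonneg_right (mul_le_of_le_one_left (h0 i x) (hA i j)) (h0 j y)
    _ = (∑ i, (cell n i).indicator (fun _ => (1 : ℝ)) x)
          * ∑ j, (cell n j).indicator (fun _ => (1 : ℝ)) y := by
        rw [Finset.sum_mul_sum]
    _ ≤ 1 := mul_le_one₀ (sum_indicator_mem x) (Finset.sum_nonneg fun j _ => h0 j y)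
        (sum_indicator_mem y)

/-- The piecewise constant graphon associated with a signed graph. -/
noncomputable def toGraphon {n : ℕ} (G : SignedGraph n) : SignedGraphon where
  toFun := G.stepFun
  measurable' := by
    change Measurable fun q : I × I => G.stepFun q.1 q.2
    unfold stepFun
    refine Finset.measurable_sum _ fun i _ => Finset.measurable_sum _ fun j _ => ?_
    exact (measurable_const.mul ((measurable_const.indicator (measurableSet_cell n i)).comp
      measurable_fst)).mul ((measurable_const.indicator (measurableSet_cell n j)).comp
      measurable_snd)
  symm' x y := by
    unfold stepFun
    rw [Finset.sum_comm]
    refine Finset.sum_congr rfl fun i _ => Finset.sum_congr rfl fun j _ => ?_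
    rw [G.symm' j i]
    ring
  abs_le_one' := G.abs_stepFun_le

end SignedGraph

/-- The pairs `i < j` of nodes. -/
abbrev NodePair (n : ℕ) : Type := {p : Fin n × Fin n // p.1 < p.2}

namespace SignedGraphon

/-- Given the points `x₁, …, x_n`: the law of independent Bernoulli variables `η_{ij}`, `i < j`,
of parameters `|W(x_i, x_j)|` (`true` stands for `1` and `false` for `0`). -/
noncomputable def edgeLaw (W : SignedGraphon) {n : ℕ} (x : Fin n → I) :
    Measure (NodePair n → Bool) :=
  Measure.pi fun p => bernoulliMeasure true false (W.edgeProb (x p.1.1) (x p.1.2))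

theorem measurable_edgeProb (W : SignedGraphon) {n : ℕ} (p : NodePair n) :
    Measurable fun x : Fin n → I => W.edgeProb (x p.1.1) (x p.1.2) := by
  have h : Measurable fun x : Fin n → I => (x p.1.1, x p.1.2) :=
    (measurable_pi_apply p.1.1).prodMk (measurable_pi_apply p.1.2)
  exact Measurable.subtype_mk ((continuous_abs.measurable.comp W.measurable').comp h)

theorem measurable_edgeLaw (W : SignedGraphon) (n : ℕ) :
    Measurable (fun x : Fin n → I => W.edgeLaw x) := by
  refine Measure.measurable_of_measurable_coe _ fun s _ => ?_
  have h : ∀ x : Fin n → I, W.edgeLaw x s = ∑' e : NodePair n → Bool,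
      s.indicator (fun e => ∏ p, bernoulliMeasure true false
        (W.edgeProb (x p.1.1) (x p.1.2)) {e p}) e := fun x => by
    rw [← Measure.tsum_indicator_apply_singleton _ _ s.toFinite.measurableSet]
    simp only [edgeLaw, Measure.pi_singleton]
  simp_rw [h]
  refine Measurable.tsum fun e => ?_
  by_cases he : e ∈ s
  · simp only [Set.indicator_of_mem he]
    refine Finset.measurable_prod _ fun p _ => ?_
    classical
    simp only [bernoulliMeasure_apply _ (measurableSet_singleton (e p))]
    have hm := W.measurable_edgeProb p
    have h1 : Measurable fun x : Fin n → I =>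
        ((toNNReal (W.edgeProb (x p.1.1) (x p.1.2)) : NNReal) : ENNReal) :=
      (ENNReal.continuous_coe.comp unitInterval.toNNReal_continuous).measurable.comp hm
    have h2 : Measurable fun x : Fin n → I =>
        ((toNNReal (σ (W.edgeProb (x p.1.1) (x p.1.2))) : NNReal) : ENNReal) :=
      ((ENNReal.continuous_coe.comp unitInterval.toNNReal_continuous).comp
        unitInterval.continuous_symm).measurable.comp hm
    cases e p <;> simp [h1, h2]
  · simp [Set.indicator_of_notMem he]

/-- `edgeLaw` as a Markov kernel in the points `x₁, …, x_n`. -/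
noncomputable def edgeKernel (W : SignedGraphon) (n : ℕ) :
    Kernel (Fin n → I) (NodePair n → Bool) where
  toFun := W.edgeLaw
  measurable' := W.measurable_edgeLaw n

instance (W : SignedGraphon) (n : ℕ) : IsMarkovKernel (W.edgeKernel n) :=
  ⟨fun x => inferInstanceAs (IsProbabilityMeasure (Measure.pi fun p : NodePair n =>
    bernoulliMeasure true false (W.edgeProb (x p.1.1) (x p.1.2))))⟩

/-- The random graph `G` on `n` nodes is sampled from `W` with latent variables `X₁, …, X_n`:
conditionally on `X`, there are independent `η_{ij} ∼ Ber(|W(X_i, X_j)|)`, `i < j`, with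
`A_{ij} = sign(W(X_i, X_j)) η_{ij}` for `i < j`. The rest of `A` follows by symmetry, up to the
diagonal, which is arbitrary in `{-1, 0, 1}`. -/
def IsSampledGraph {Ω : Type*} [MeasurableSpace Ω] (P : Measure Ω) (W : SignedGraphon) {n : ℕ}
    (X : Ω → Fin n → I) (G : Ω → SignedGraph n) : Prop :=
  ∃ η : Ω → NodePair n → Bool, HasCondDistrib η X (W.edgeKernel n) P ∧
    ∀ (ω : Ω) (p : NodePair n),
      (G ω).adj p.1.1 p.1.2 = Real.sign (W (X ω p.1.1) (X ω p.1.2)) * if η ω p then 1 else 0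

end SignedGraphon

/-- Deterministic latent variables: `X_i = i/n`, `i = 1, …, n` (numbered from `0` here). -/
def IsDeterministicLatent {Ω : Type*} {n : ℕ} (X : Ω → Fin n → I) : Prop :=
  ∀ ω i, (X ω i : ℝ) = (((i : ℕ) : ℝ) + 1) / n

/-- Stochastic latent variables: `X_i = U_{(i)}`, the order statistics of i.i.d. uniform
`U₁, …, U_n` in `[0,1]`. -/
def IsStochasticLatent {Ω : Type*} [MeasurableSpace Ω] (P : Measure Ω) {n : ℕ}
    (X : Ω → Fin n → I) : Prop :=
  ∃ U : Fin n → Ω → I, (∀ i, HasLaw (U i) volume P) ∧ iIndepFun U P ∧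
    ∀ ω i, X ω i = U (Tuple.sort (fun k => U k ω) i) ω

/-! Since `T` is additive in the kernel, it suffices to treat the positive and negative parts. Let
`V` be one of them. The sampled part is compared with `V` through the intermediate step graphon
`sampleGraphon V X`, with value `V (X i) (X j)` on the cell `I_i × I_j`.

Discretization: `V` is continuous off the finitely many grid lines, a null set, and the latent
variable of the cell containing `x` tends to `x`. Hence the step graphons converge to `V` almost
everywhere, so by dominated convergence in Hilbert–Schmidt norm, which dominates the operator norm
(`tendsto_norm_T_sampleGraphon`). For order statistics, convergence of the latent variables comes
from Hoeffding's inequality at rational points and Borel–Cantelli.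

Noise: off the diagonal the remaining matrix has entries `h (η - |W|)` with `h` the indicator of the
sign in question, centered and independent for `i < j` given `X`. Hoeffding and a union bound over
the `4 ^ n` pairs of sign vectors bound the bilinear form by `4 n √n`, with summable exceptional
probabilities. For entries in `[-1,1]`, the fourth power of the operator norm of a step kernel is at
most this cut-type norm divided by `n ^ 2` (`norm_T_sub_pow_four_le`), hence `O(1/√n)`.
Borel–Cantelli uses only the law for each single `n`. -/

/-- The real number `±1` encoded by a Boolean. -/
def boolSign (b : Bool) : ℝ := if b then 1 else -1

theorem abs_boolSign (b : Bool) : |boolSign b| = 1 := by cases b <;> simp [boolSign]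

theorem exists_boolSign_mul_eq_abs (a : ℝ) : ∃ b, boolSign b * a = |a| := by
  rcases le_total 0 a with h | h
  · exact ⟨true, by simp [boolSign, abs_of_nonneg h]⟩
  · exact ⟨false, by simp [boolSign, abs_of_nonpos h]⟩

/-! ### Cut norm and spectral norm of matrices -/

section Matrix

variable {ι : Type*} [Fintype ι]

/-- A bound for a bilinear form on sign vectors extends to the cube `[-1,1]^ι`. -/
theorem bilin_le_of_bilin_boolSign_le {d : ι → ι → ℝ} {c : ℝ}
    (hc : ∀ s t : ι → Bool, ∑ i, ∑ j, d i j * (boolSign (s i) * boolSign (t j)) ≤ c)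
    {u v : ι → ℝ} (hu : ∀ i, |u i| ≤ 1) (hv : ∀ i, |v i| ≤ 1) :
    ∑ i, ∑ j, d i j * (u i * v j) ≤ c := by
  have key : ∀ a b : ℝ, |b| ≤ 1 → b * a ≤ |a| := fun a b hb =>
    (le_abs_self _).trans (by rw [abs_mul]; exact mul_le_of_le_one_left (abs_nonneg a) hb)
  choose s hs using fun i => exists_boolSign_mul_eq_abs (∑ j, d i j * v j)
  choose t ht using fun j => exists_boolSign_mul_eq_abs (∑ i, boolSign (s i) * d i j)
  calc ∑ i, ∑ j, d i j * (u i * v j) = ∑ i, u i * ∑ j, d i j * v j := by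
        refine Finset.sum_congr rfl fun i _ => ?_
        rw [Finset.mul_sum]
        exact Finset.sum_congr rfl fun j _ => by ring
    _ ≤ ∑ i, boolSign (s i) * ∑ j, d i j * v j :=
        Finset.sum_le_sum fun i _ => (key _ _ (hu i)).trans (hs i).ge
    _ = ∑ j, v j * ∑ i, boolSign (s i) * d i j := by
        simp_rw [Finset.mul_sum]
        rw [Finset.sum_comm]
        exact Finset.sum_congr rfl fun j _ => Finset.sum_congr rfl fun i _ => by ring
    _ ≤ ∑ j, boolSign (t j) * ∑ i, boolSign (s i) * d i j :=
        Finset.sum_le_sum fun j _ => (key _ _ (hv j)).trans (ht j).ge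
    _ = ∑ i, ∑ j, d i j * (boolSign (s i) * boolSign (t j)) := by
        simp_rw [Finset.mul_sum]
        rw [Finset.sum_comm]
        exact Finset.sum_congr rfl fun j _ => Finset.sum_congr rfl fun i _ => by ring
    _ ≤ c := hc s t

/-- The spectral norm of a matrix with entries in `[-1,1]` is controlled by its cut norm. -/
theorem sum_sq_mulVec_sq_le {d : ι → ι → ℝ} (hd : ∀ i j, |d i j| ≤ 1) {c : ℝ}
    (hc : ∀ s t : ι → Bool, ∑ i, ∑ j, d i j * (boolSign (s i) * boolSign (t j)) ≤ c)
    (F : ι → ℝ) :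
    (∑ i, (∑ j, d i j * F j) ^ 2) ^ 2 ≤ (Fintype.card ι) ^ 2 * c * (∑ j, F j ^ 2) ^ 2 := by
  -- `M` is the Gram matrix `dᵀd`, so `|dF|² = ⟨F, M F⟩`, and Cauchy–Schwarz bounds this by the
  -- Frobenius norm of `M` times `|F|²`.
  set M : ι × ι → ℝ := fun p => ∑ i, d i p.1 * d i p.2 with hM
  have h1 : ∑ i, (∑ j, d i j * F j) ^ 2 = ∑ p : ι × ι, M p * (F p.1 * F p.2) := by
    rw [Fintype.sum_prod_type]
    simp_rw [hM, Finset.sum_mul, sq, Finset.sum_mul_sum]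
    rw [Finset.sum_comm]
    refine Finset.sum_congr rfl fun j _ => ?_
    rw [Finset.sum_comm]
    exact Finset.sum_congr rfl fun k _ => Finset.sum_congr rfl fun i _ => by ring
  have h2 : ∑ p : ι × ι, (F p.1 * F p.2) ^ 2 = (∑ j, F j ^ 2) ^ 2 := by
    rw [Fintype.sum_prod_type, sq, Finset.sum_mul_sum]
    simp_rw [mul_pow]
  -- For fixed `k, l` the inner sum is the bilinear form of `d` at `u i = d i k * d l k` and `v j =
  -- d l j`, both in the cube; each is at most `c`.
  have h3 : ∑ p : ι × ι, M p ^ 2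
      = ∑ k, ∑ l, ∑ i, ∑ j, d i j * ((d i k * d l k) * d l j) := by
    rw [Fintype.sum_prod_type, Finset.sum_comm]
    refine Finset.sum_congr rfl fun k _ => ?_
    simp_rw [hM, sq, Finset.sum_mul_sum]
    rw [Finset.sum_comm]
    rw [Finset.sum_congr rfl fun i _ => Finset.sum_comm]
    rw [Finset.sum_comm]
    refine Finset.sum_congr rfl fun l _ => Finset.sum_congr rfl fun i _ =>
      Finset.sum_congr rfl fun j _ => by ring
  have h4 : ∑ p : ι × ι, M p ^ 2 ≤ (Fintype.card ι) ^ 2 * c := by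
    rw [h3]
    calc _ ≤ ∑ _k : ι, ∑ _l : ι, c := Finset.sum_le_sum fun k _ => Finset.sum_le_sum fun l _ =>
          bilin_le_of_bilin_boolSign_le hc (fun i => by
            rw [abs_mul]; exact mul_le_one₀ (hd _ _) (abs_nonneg _) (hd _ _)) (hd l)
      _ = _ := by simp; ring
  rw [h1]
  refine (Finset.sum_mul_sq_le_sq_mul_sq _ _ _).trans ?_
  rw [h2]
  exact mul_le_mul_of_nonneg_right h4 (sq_nonneg _)

end Matrix

/-! ### Integral operators and the Hilbert–Schmidt bound -/

/-- The Cauchy–Schwarz inequality for the integral of a product. -/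
theorem sq_integral_mul_le {α : Type*} [MeasurableSpace α] {μ : Measure α} {f g : α → ℝ}
    (hf : MemLp f 2 μ) (hg : MemLp g 2 μ) :
    (∫ x, f x * g x ∂μ) ^ 2 ≤ (∫ x, f x ^ 2 ∂μ) * ∫ x, g x ^ 2 ∂μ := by
  have key : ∀ {u v : α → ℝ} (hu : MemLp u 2 μ) (hv : MemLp v 2 μ),
      inner ℝ (hu.toLp u) (hv.toLp v) = ∫ x, u x * v x ∂μ := fun hu hv => by
    rw [L2.inner_def]
    refine integral_congr_ae ?_
    filter_upwards [hu.coeFn_toLp, hv.coeFn_toLp] with x h1 h2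
    rw [h1, h2]
    simp [mul_comm]
  have h := real_inner_mul_inner_self_le (hf.toLp f) (hg.toLp g)
  rw [key, key, key] at h
  simpa [sq] using h

namespace SignedGraphon

theorem norm_sq_L2 (f : L2) : ‖f‖ ^ 2 = ∫ x, f x ^ 2 := by
  rw [← real_inner_self_eq_norm_sq, L2.inner_def]
  simp [sq]

theorem T_apply_ae (W : SignedGraphon) (f : L2) :
    W.T f =ᵐ[volume] fun x => ∫ y, W x y * f y :=
  MemLp.coeFn_toLp (W.memLp_integral f)

theorem norm_T_sub_apply_sq (U V : SignedGraphon) (f : L2) :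
    ‖(U.T - V.T) f‖ ^ 2 = ∫ x, (∫ y, (U x y - V x y) * f y) ^ 2 := by
  rw [norm_sq_L2]
  refine integral_congr_ae ?_
  rw [_root_.sub_apply]
  filter_upwards [Lp.coeFn_sub (U.T f) (V.T f), U.T_apply_ae f, V.T_apply_ae f] with x h1 h2 h3
  rw [h1, Pi.sub_apply, h2, h3, ← integral_sub (U.integrable_mul f x) (V.integrable_mul f x)]
  simp_rw [sub_mul]

theorem abs_sub_le_two (U V : SignedGraphon) (x y : I) : |U x y - V x y| ≤ 2 := by
  have h1 := abs_le.1 (U.abs_le_one' x y)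
  have h2 := abs_le.1 (V.abs_le_one' x y)
  exact abs_le.2 ⟨by linarith, by linarith⟩

theorem measurable_sub (U V : SignedGraphon) :
    Measurable fun p : I × I => U p.1 p.2 - V p.1 p.2 :=
  U.measurable'.sub V.measurable'

theorem integrable_sub_sq (U V : SignedGraphon) :
    Integrable (fun p : I × I => (U p.1 p.2 - V p.1 p.2) ^ 2) volume := by
  refine Integrable.of_bound ((measurable_sub U V).pow_const 2).aestronglyMeasurable 4
    (ae_of_all _ fun p => ?_)
  have := abs_sub_le_two U V p.1 p.2
  rw [Real.norm_eq_abs, abs_pow]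
  nlinarith [abs_nonneg (U p.1 p.2 - V p.1 p.2)]

theorem norm_T_sub_sq_le_of_forall (U V : SignedGraphon) {c : ℝ} (hc : 0 ≤ c)
    (h : ∀ f : L2, ∫ x, (∫ y, (U x y - V x y) * f y) ^ 2 ≤ c * ‖f‖ ^ 2) :
    ‖U.T - V.T‖ ^ 2 ≤ c := by
  have h1 : ‖U.T - V.T‖ ≤ √c := by
    refine ContinuousLinearMap.opNorm_le_bound _ (Real.sqrt_nonneg c) fun f => ?_
    refine abs_le_of_sq_le_sq' ?_ (by positivity) |>.2
    rw [norm_T_sub_apply_sq, mul_pow, Real.sq_sqrt hc]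
    exact h f
  calc ‖U.T - V.T‖ ^ 2 ≤ √c ^ 2 := by gcongr
    _ = c := Real.sq_sqrt hc

/-- The operator norm is at most the Hilbert–Schmidt norm. -/
theorem norm_T_sub_sq_le (U V : SignedGraphon) :
    ‖U.T - V.T‖ ^ 2 ≤ ∫ p : I × I, (U p.1 p.2 - V p.1 p.2) ^ 2 := by
  refine norm_T_sub_sq_le_of_forall U V (integral_nonneg fun p => sq_nonneg _) fun f => ?_
  have hint := integrable_sub_sq U V
  rw [Measure.volume_eq_prod] at hint ⊢
  rw [integral_prod _ hint, ← integral_mul_const]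
  refine integral_mono_of_nonneg (ae_of_all _ fun x => sq_nonneg _)
    (hint.integral_prod_left.mul_const _) (ae_of_all _ fun x => ?_)
  have hk : MemLp (fun y => U x y - V x y) 2 (volume : Measure I) :=
    MemLp.of_bound ((U.measurable_section x).sub (V.measurable_section x)).aestronglyMeasurable 2
      (ae_of_all _ fun y => abs_sub_le_two U V x y)
  rw [norm_sq_L2]
  exact sq_integral_mul_le hk (Lp.memLp f)

/-- Operators converge in norm when their kernels converge almost everywhere. -/
theorem tendsto_norm_T_sub_of_ae {U : ℕ → SignedGraphon} {V : SignedGraphon}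
    (h : ∀ᵐ p : I × I, Tendsto (fun n => U n p.1 p.2) atTop (𝓝 (V p.1 p.2))) :
    Tendsto (fun n => ‖(U n).T - V.T‖) atTop (𝓝 0) := by
  have h1 : Tendsto (fun n => ∫ p : I × I, (U n p.1 p.2 - V p.1 p.2) ^ 2) atTop
      (𝓝 (∫ _ : I × I, (0 : ℝ))) := by
    refine tendsto_integral_of_dominated_convergence (fun _ => 4)
      (fun n => ((measurable_sub (U n) V).pow_const 2).aestronglyMeasurable)
      (integrable_const _) (fun n => ae_of_all _ fun p => ?_) ?_
    · have := abs_sub_le_two (U n) V p.1 p.2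
      rw [Real.norm_eq_abs, abs_pow]
      nlinarith [abs_nonneg (U n p.1 p.2 - V p.1 p.2)]
    · filter_upwards [h] with p hp
      simpa using (hp.sub_const (V p.1 p.2)).pow 2
  rw [integral_zero] at h1
  have h2 : Tendsto (fun n => ‖(U n).T - V.T‖ ^ 2) atTop (𝓝 0) :=
    squeeze_zero (fun n => sq_nonneg _) (fun n => norm_T_sub_sq_le (U n) V) h1
  simpa [Real.sqrt_sq] using h2.sqrt

end SignedGraphon

/-! ### Step kernels and their operator norm -/

namespace SignedGraph

/-- The kernel equal to `a i j` on `I_i × I_j`. -/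
noncomputable def stepKernel {n : ℕ} (a : Fin n → Fin n → ℝ) (x y : I) : ℝ :=
  ∑ i, ∑ j, a i j * (cell n i).indicator (fun _ => (1 : ℝ)) x
    * (cell n j).indicator (fun _ => (1 : ℝ)) y

theorem stepKernel_of_mem {n : ℕ} (a : Fin n → Fin n → ℝ) {x y : I} {i j : Fin n}
    (hx : x ∈ cell n i) (hy : y ∈ cell n j) : stepKernel a x y = a i j := by
  unfold stepKernel
  rw [Finset.sum_eq_single i, Finset.sum_eq_single j]
  · simp [hx, hy]
  · intro k _ hk
    rw [Set.indicator_of_notMem (fun h => hk (cell_unique h hy)), mul_zero]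
  · simp
  · intro k _ hk
    refine Finset.sum_eq_zero fun l _ => ?_
    rw [Set.indicator_of_notMem (fun h => hk (cell_unique h hx)), mul_zero, zero_mul]
  · simp

theorem stepKernel_of_notMem_left {n : ℕ} (a : Fin n → Fin n → ℝ) {x : I} (y : I)
    (hx : ∀ i, x ∉ cell n i) : stepKernel a x y = 0 :=
  Finset.sum_eq_zero fun i _ => Finset.sum_eq_zero fun j _ => by
    rw [Set.indicator_of_notMem (hx i), mul_zero, zero_mul]

theorem stepKernel_of_notMem_right {n : ℕ} (a : Fin n → Fin n → ℝ) (x : I) {y : I}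
    (hy : ∀ i, y ∉ cell n i) : stepKernel a x y = 0 :=
  Finset.sum_eq_zero fun i _ => Finset.sum_eq_zero fun j _ => by
    rw [Set.indicator_of_notMem (hy j), mul_zero]

/-- Applying a function that fixes `0` to a step kernel entrywise. -/
theorem comp_stepKernel {n : ℕ} (a : Fin n → Fin n → ℝ) {φ : ℝ → ℝ} (hφ : φ 0 = 0) (x y : I) :
    φ (stepKernel a x y) = stepKernel (fun i j => φ (a i j)) x y := by
  by_cases hx : ∃ i, x ∈ cell n i
  · by_cases hy : ∃ j, y ∈ cell n j
    · obtain ⟨i, hi⟩ := hx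
      obtain ⟨j, hj⟩ := hy
      rw [stepKernel_of_mem _ hi hj, stepKernel_of_mem _ hi hj]
    · push Not at hy
      rw [stepKernel_of_notMem_right _ x hy, stepKernel_of_notMem_right _ x hy, hφ]
  · push Not at hx
    rw [stepKernel_of_notMem_left _ y hx, stepKernel_of_notMem_left _ y hx, hφ]

theorem stepKernel_sub {n : ℕ} (a b : Fin n → Fin n → ℝ) (x y : I) :
    stepKernel a x y - stepKernel b x y = stepKernel (fun i j => a i j - b i j) x y := by
  simp only [stepKernel, ← Finset.sum_sub_distrib, sub_mul]

theorem measurable_stepKernel {n : ℕ} (a : Fin n → Fin n → ℝ) :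
    Measurable (Function.uncurry (stepKernel a)) := by
  change Measurable fun q : I × I => stepKernel a q.1 q.2
  unfold stepKernel
  refine Finset.measurable_sum _ fun i _ => Finset.measurable_sum _ fun j _ => ?_
  exact (measurable_const.mul ((measurable_const.indicator (measurableSet_cell n i)).comp
    measurable_fst)).mul ((measurable_const.indicator (measurableSet_cell n j)).comp
    measurable_snd)

/-- The graphon with value `W (x i) (x j)` on `I_i × I_j`. -/
noncomputable def sampleGraphon (W : SignedGraphon) {n : ℕ} (x : Fin n → I) : SignedGraphon where
  toFun := stepKernel fun i j => W (x i) (x j)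
  measurable' := measurable_stepKernel _
  symm' u v := by
    unfold stepKernel
    rw [Finset.sum_comm]
    refine Finset.sum_congr rfl fun i _ => Finset.sum_congr rfl fun j _ => ?_
    simp only [W.symm' (x j) (x i)]
    ring
  abs_le_one' u v := by
    by_cases hu : ∃ i, u ∈ cell n i
    · by_cases hv : ∃ j, v ∈ cell n j
      · obtain ⟨i, hi⟩ := hu
        obtain ⟨j, hj⟩ := hv
        rw [stepKernel_of_mem _ hi hj]
        exact W.abs_le_one' _ _
      · push Not at hv
        simp [stepKernel_of_notMem_right _ u hv]
    · push Not at hu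
      simp [stepKernel_of_notMem_left _ v hu]

theorem volume_real_cell_le (n : ℕ) (i : Fin n) :
    (volume : Measure I).real (cell n i) ≤ 1 / n := by
  have hn : (0 : ℝ) < n := by exact_mod_cast i.pos
  have h0 : (0 : ℝ) ≤ (i : ℕ) / n := by positivity
  have h1 : (((i : ℕ) : ℝ) + 1) / n ≤ 1 := by
    rw [div_le_one hn]
    exact_mod_cast i.2
  have h2 : ((i : ℕ) : ℝ) / n ≤ (((i : ℕ) : ℝ) + 1) / n := by gcongr; linarith
  have h : cell n i = Set.Ioc (⟨(i : ℕ) / n, h0, h2.trans h1⟩ : I)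
      ⟨(((i : ℕ) : ℝ) + 1) / n, h0.trans h2, h1⟩ := by
    ext x
    simp [cell, ← Subtype.coe_lt_coe, ← Subtype.coe_le_coe]
  rw [measureReal_def, h, unitInterval.volume_Ioc]
  rw [ENNReal.toReal_ofReal (by simpa using h2)]
  simp only
  rw [← sub_div]
  simp

open SignedGraphon in
/-- For a step kernel the operator norm is controlled by the cut norm of the matrix. -/
theorem norm_T_sub_pow_four_le {n : ℕ} {U V : SignedGraphon} {d : Fin n → Fin n → ℝ}
    (hUV : ∀ x y, U x y - V x y = stepKernel d x y) (hd : ∀ i j, |d i j| ≤ 1) {c : ℝ}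
    (hc0 : 0 ≤ c)
    (hc : ∀ s t : Fin n → Bool, ∑ i, ∑ j, d i j * (boolSign (s i) * boolSign (t j)) ≤ c) :
    ‖U.T - V.T‖ ^ 4 ≤ c / n ^ 2 := by
  suffices h : ‖U.T - V.T‖ ^ 2 ≤ √(c / n ^ 2) by
    calc ‖U.T - V.T‖ ^ 4 = (‖U.T - V.T‖ ^ 2) ^ 2 := by ring
      _ ≤ √(c / n ^ 2) ^ 2 := by gcongr
      _ = _ := Real.sq_sqrt (by positivity)
  refine norm_T_sub_sq_le_of_forall U V (Real.sqrt_nonneg _) fun f => ?_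
  set e : Fin n → I → ℝ := fun i => (cell n i).indicator fun _ => (1 : ℝ) with he
  have hem : ∀ i, MemLp (e i) 2 (volume : Measure I) := fun i =>
    memLp_indicator_const 2 (measurableSet_cell n i) 1 (Or.inr (measure_ne_top _ _))
  set F : Fin n → ℝ := fun j => ∫ y, e j y * f y with hF
  have hfi : ∀ j, Integrable (fun y => e j y * f y) volume := fun j =>
    (hem j).integrable_mul (Lp.memLp f)
  set g : Fin n → ℝ := fun i => ∑ j, d i j * F j with hg
  have hSf : ∀ x, ∫ y, (U x y - V x y) * f y = ∑ i, e i x * g i := fun x => by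
    have : ∀ y, (U x y - V x y) * f y = ∑ i, ∑ j, (e i x * d i j) * (e j y * f y) := fun y => by
      rw [hUV, stepKernel, Finset.sum_mul]
      refine Finset.sum_congr rfl fun i _ => ?_
      rw [Finset.sum_mul]
      exact Finset.sum_congr rfl fun j _ => by simp only [he]; ring
    simp_rw [this]
    rw [integral_finsetSum _ fun i _ => integrable_finsetSum _ fun j _ => (hfi j).const_mul _]
    refine Finset.sum_congr rfl fun i _ => ?_
    rw [integral_finsetSum _ fun j _ => (hfi j).const_mul _, hg, Finset.mul_sum]
    refine Finset.sum_congr rfl fun j _ => ?_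
    rw [integral_const_mul, mul_assoc]
  -- The cells are disjoint, so the cross terms of the square vanish.
  have hsq : ∀ x, (∑ i, e i x * g i) ^ 2 = ∑ i, e i x * g i ^ 2 := fun x => by
    by_cases hx : ∃ i, x ∈ cell n i
    · obtain ⟨i, hi⟩ := hx
      have hz : ∀ j, j ≠ i → e j x = 0 := fun j hj =>
        Set.indicator_of_notMem (fun h => hj (cell_unique h hi)) _
      have h1 : e i x = 1 := Set.indicator_of_mem hi _
      rw [Finset.sum_eq_single i (fun j _ hj => by rw [hz j hj, zero_mul]) (by simp),
        Finset.sum_eq_single i (fun j _ hj => by rw [hz j hj, zero_mul]) (by simp), h1]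
      ring
    · push Not at hx
      have hz : ∀ j, e j x = 0 := fun j => Set.indicator_of_notMem (hx j) _
      simp [hz]
  have hvol : ∀ i, ∫ x, e i x = (volume : Measure I).real (cell n i) := fun i => by
    simp [he, integral_indicator_const _ (measurableSet_cell n i)]
  have h1 : ∫ x, (∫ y, (U x y - V x y) * f y) ^ 2 ≤ 1 / n * ∑ i, g i ^ 2 := by
    simp_rw [hSf, hsq]
    rw [integral_finsetSum _ fun i _ => ((hem i).integrable (by norm_num)).mul_const _,
      Finset.mul_sum]
    refine Finset.sum_le_sum fun i _ => ?_
    rw [integral_mul_const, hvol]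
    exact mul_le_mul_of_nonneg_right (volume_real_cell_le n i) (sq_nonneg _)
  have hf2 : Integrable (fun y => f y ^ 2) volume := (Lp.memLp f).integrable_sq
  have hef2 : ∀ j, Integrable (fun y => e j y * f y ^ 2) volume := fun j => by
    refine hf2.bdd_mul (c := 1) (hem j).aestronglyMeasurable (ae_of_all _ fun y => ?_)
    by_cases hy : y ∈ cell n j <;> simp [he, hy]
  -- Cauchy–Schwarz for `e j` and `e j * f`, using `e j ^ 2 = e j`. This yields one factor `1 / n`;
  -- the cell volume in `h1` yields the other.
  have hFj : ∀ j, F j ^ 2 ≤ 1 / n * ∫ y, e j y * f y ^ 2 := fun j => by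
    have hee : ∀ y, e j y ^ 2 = e j y := fun y => by
      by_cases hy : y ∈ cell n j <;> simp [he, hy]
    have h2 : MemLp (fun y => e j y * f y) 2 (volume : Measure I) := by
      refine (memLp_two_iff_integrable_sq (hfi j).aestronglyMeasurable).2 ?_
      simpa only [mul_pow, hee] using hef2 j
    have h3 := sq_integral_mul_le (hem j) h2
    have h4 : ∀ y, e j y * (e j y * f y) = e j y * f y := fun y => by
      rw [← mul_assoc, ← sq, hee]
    simp only [h4, mul_pow, hee, hvol] at h3
    refine h3.trans (mul_le_mul_of_nonneg_right (volume_real_cell_le n j)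
      (integral_nonneg fun y => mul_nonneg ?_ (sq_nonneg _)))
    exact Set.indicator_nonneg (fun _ _ => zero_le_one) y
  have hFsum : ∑ j, F j ^ 2 ≤ 1 / n * ‖f‖ ^ 2 := by
    refine (Finset.sum_le_sum fun j _ => hFj j).trans ?_
    rw [← Finset.mul_sum, norm_sq_L2, ← integral_finsetSum _ fun j _ => hef2 j]
    refine mul_le_mul_of_nonneg_left ?_ (by positivity)
    refine integral_mono (integrable_finsetSum _ fun j _ => hef2 j) hf2 fun y => ?_
    simp only [← Finset.sum_mul]
    exact mul_le_of_le_one_left (sq_nonneg _) (sum_indicator_mem y)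
  have h5 := sum_sq_mulVec_sq_le hd hc F
  rw [Fintype.card_fin] at h5
  rcases Nat.eq_zero_or_pos n with rfl | hn
  · simpa using h1
  have hn' : (0 : ℝ) < n := by exact_mod_cast hn
  refine h1.trans (abs_le_of_sq_le_sq' ?_ (by positivity)).2
  rw [mul_pow, mul_pow, Real.sq_sqrt (by positivity)]
  calc (1 / (n : ℝ)) ^ 2 * (∑ i, g i ^ 2) ^ 2
      ≤ (1 / (n : ℝ)) ^ 2 * (n ^ 2 * c * (∑ j, F j ^ 2) ^ 2) := by gcongr
    _ ≤ (1 / (n : ℝ)) ^ 2 * (n ^ 2 * c * (1 / n * ‖f‖ ^ 2) ^ 2) := by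
        gcongr
    _ = c / n ^ 2 * (‖f‖ ^ 2) ^ 2 := by field_simp

end SignedGraph

/-! ### Latent variables and almost everywhere continuity -/

/-- The latent variable attached to the cell of `x` converges to `x`, for all `0 < x < 1`. -/
def LatentConverges (X : (n : ℕ) → Fin n → I) : Prop :=
  ∀ x : I, (0 : ℝ) < x → (x : ℝ) < 1 → ∀ ε > (0 : ℝ), ∀ᶠ n in atTop, ∀ i : Fin n,
    x ∈ SignedGraph.cell n i → |(X n i : ℝ) - x| < ε

/-- The index is `⌈n x⌉`, lowered by one since nodes start at `0`. The cells are open on the left,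
so the point `0` lies in none. -/
theorem SignedGraph.exists_mem_cell {n : ℕ} (hn : 0 < n) {x : I} (hx : (0 : ℝ) < x) :
    ∃ i, x ∈ SignedGraph.cell n i := by
  have hn' : (0 : ℝ) < n := by exact_mod_cast hn
  have hpos : 0 < ⌈(n : ℝ) * x⌉₊ := Nat.ceil_pos.2 (by positivity)
  have hle : ⌈(n : ℝ) * x⌉₊ ≤ n := Nat.ceil_le.2 (mul_le_of_le_one_right hn'.le x.2.2)
  have h1 : ((⌈(n : ℝ) * x⌉₊ - 1 : ℕ) : ℝ) = ⌈(n : ℝ) * x⌉₊ - 1 := by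
    rw [Nat.cast_sub hpos, Nat.cast_one]
  refine ⟨⟨⌈(n : ℝ) * x⌉₊ - 1, by omega⟩, ?_, ?_⟩
  · simp only [h1]
    rw [div_lt_iff₀ hn']
    have := Nat.ceil_lt_add_one (mul_nonneg hn'.le x.2.1)
    linarith
  · simp only [h1]
    rw [le_div_iff₀ hn']
    have := Nat.le_ceil ((n : ℝ) * x)
    linarith

/-- The latent variable is the right endpoint of its cell, hence within `1 / n` of every point of
it. -/
theorem IsDeterministicLatent.latentConverges {Ω : Type*} {X : (n : ℕ) → Ω → Fin n → I}
    (hX : ∀ n, IsDeterministicLatent (X n)) (ω : Ω) : LatentConverges fun n => X n ω := by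
  intro x _ _ ε hε
  filter_upwards [(tendsto_one_div_atTop_nhds_zero_nat (𝕜 := ℝ)).eventually_lt_const hε]
    with n hn i hi
  rw [hX n ω i, abs_of_nonneg (sub_nonneg.2 hi.2)]
  have h1 := hi.1
  rw [add_div]
  linarith

namespace SignedGraphon

/-- If `x` missed every open piece, induction along the breakpoints would put all of them, even the
last, below `x`. -/
theorem exists_mem_Ioo_of_notMem_range {K : ℕ} {α : Fin (K + 2) → ℝ} {x : ℝ}
    (h0 : α 0 < x) (h1 : x < α (Fin.last (K + 1))) (hx : x ∉ Set.range α) :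
    ∃ k : Fin (K + 1), x ∈ Set.Ioo (α k.castSucc) (α k.succ) := by
  by_contra! h
  have key : ∀ k : Fin (K + 2), α k < x := fun k => by
    induction k using Fin.induction with
    | zero => exact h0
    | succ k ih =>
      by_contra! hle
      exact h k ⟨ih, lt_of_le_of_ne hle fun he => hx ⟨_, he.symm⟩⟩
  exact absurd (key _) h1.not_gt

/-- A piecewise Lipschitz graphon is continuous at almost every point. -/
theorem IsPiecewiseLipschitz.ae_continuousAt {W : SignedGraphon} (hW : W.IsPiecewiseLipschitz) :
    ∀ᵐ p : I × I, (0 : ℝ) < p.1 ∧ (p.1 : ℝ) < 1 ∧ (0 : ℝ) < p.2 ∧ (p.2 : ℝ) < 1 ∧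
      ContinuousAt (Function.uncurry W) p := by
  obtain ⟨K, α, L, -, h0, h1, hL⟩ := hW
  have hN : ∀ᵐ x : I, (x : ℝ) ∉ Set.range α := by
    have hfin : {x : I | (x : ℝ) ∈ Set.range α}.Finite :=
      (Set.finite_range α).preimage Subtype.val_injective.injOn
    refine measure_mono_null (fun x hx => ?_) (hfin.measure_zero volume)
    simpa using hx
  rw [Measure.volume_eq_prod]
  filter_upwards [Measure.quasiMeasurePreserving_fst.ae hN,
    Measure.quasiMeasurePreserving_snd.ae hN] with p hp1 hp2
  -- The endpoints `0` and `1` are themselves breakpoints, so avoiding the breakpoints gives strict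
  -- inequalities.
  have aux : ∀ x : I, (x : ℝ) ∉ Set.range α → (0 : ℝ) < x ∧ (x : ℝ) < 1 := fun x hx =>
    ⟨lt_of_le_of_ne x.2.1 fun h => hx ⟨0, h0.trans h⟩,
      lt_of_le_of_ne x.2.2 fun h => hx ⟨_, h1.trans h.symm⟩⟩
  obtain ⟨k, hk⟩ := exists_mem_Ioo_of_notMem_range (h0 ▸ (aux _ hp1).1) (h1 ▸ (aux _ hp1).2) hp1
  obtain ⟨l, hl⟩ := exists_mem_Ioo_of_notMem_range (h0 ▸ (aux _ hp2).1) (h1 ▸ (aux _ hp2).2) hp2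
  refine ⟨(aux _ hp1).1, (aux _ hp1).2, (aux _ hp2).1, (aux _ hp2).2, ?_⟩
  have e1 : ∀ᶠ q : I × I in 𝓝 p, (q.1 : ℝ) ∈ Set.Ioo (α k.castSucc) (α k.succ) :=
    (continuous_subtype_val.comp continuous_fst).continuousAt.eventually (isOpen_Ioo.mem_nhds hk)
  have e2 : ∀ᶠ q : I × I in 𝓝 p, (q.2 : ℝ) ∈ Set.Ioo (α l.castSucc) (α l.succ) :=
    (continuous_subtype_val.comp continuous_snd).continuousAt.eventually (isOpen_Ioo.mem_nhds hl)
  rw [ContinuousAt, tendsto_iff_dist_tendsto_zero]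
  have hlim : Tendsto (fun q : I × I => L * (|(q.1 : ℝ) - p.1| + |(q.2 : ℝ) - p.2|)) (𝓝 p)
      (𝓝 0) := by
    have : Continuous fun q : I × I => L * (|(q.1 : ℝ) - p.1| + |(q.2 : ℝ) - p.2|) := by fun_prop
    simpa using this.tendsto p
  refine squeeze_zero' (Eventually.of_forall fun _ => dist_nonneg) ?_ hlim
  filter_upwards [e1, e2] with q hq1 hq2
  rw [Real.dist_eq]
  exact hL k l _ _ _ _ hq1 hk hq2 hl

/-- The operators of the graphons `V (X i) (X j)` converge in norm to that of `V`. -/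
theorem tendsto_norm_T_sampleGraphon {V : SignedGraphon}
    (hV : ∀ᵐ p : I × I, (0 : ℝ) < p.1 ∧ (p.1 : ℝ) < 1 ∧ (0 : ℝ) < p.2 ∧ (p.2 : ℝ) < 1 ∧
      ContinuousAt (Function.uncurry V) p)
    {X : (n : ℕ) → Fin n → I} (hX : LatentConverges X) :
    Tendsto (fun n => ‖(SignedGraph.sampleGraphon V (X n)).T - V.T‖) atTop (𝓝 0) := by
  refine tendsto_norm_T_sub_of_ae ?_
  filter_upwards [hV] with p hp
  obtain ⟨h1, h2, h3, h4, hc⟩ := hp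
  refine Metric.tendsto_nhds.2 fun ε hε => ?_
  obtain ⟨δ, hδ, hδ'⟩ := Metric.continuousAt_iff.1 hc ε hε
  filter_upwards [hX p.1 h1 h2 δ hδ, hX p.2 h3 h4 δ hδ, eventually_gt_atTop 0] with n hn1 hn2 hn
  obtain ⟨i, hi⟩ := SignedGraph.exists_mem_cell hn h1
  obtain ⟨j, hj⟩ := SignedGraph.exists_mem_cell hn h3
  have hval : SignedGraph.sampleGraphon V (X n) p.1 p.2 = V (X n i) (X n j) :=
    SignedGraph.stepKernel_of_mem _ hi hj
  rw [hval]
  refine hδ' (x := (X n i, X n j)) ?_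
  rw [Prod.dist_eq]
  exact max_lt (hn1 i hi) (hn2 j hj)

theorem ae_continuousAt_posPart {W : SignedGraphon} (hW : W.IsPiecewiseLipschitz) :
    ∀ᵐ p : I × I, (0 : ℝ) < p.1 ∧ (p.1 : ℝ) < 1 ∧ (0 : ℝ) < p.2 ∧ (p.2 : ℝ) < 1 ∧
      ContinuousAt (Function.uncurry W.posPart) p := by
  filter_upwards [hW.ae_continuousAt] with p hp
  exact ⟨hp.1, hp.2.1, hp.2.2.1, hp.2.2.2.1, hp.2.2.2.2.max continuousAt_const⟩

theorem ae_continuousAt_negPart {W : SignedGraphon} (hW : W.IsPiecewiseLipschitz) :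
    ∀ᵐ p : I × I, (0 : ℝ) < p.1 ∧ (p.1 : ℝ) < 1 ∧ (0 : ℝ) < p.2 ∧ (p.2 : ℝ) < 1 ∧
      ContinuousAt (Function.uncurry W.negPart) p := by
  filter_upwards [hW.ae_continuousAt] with p hp
  exact ⟨hp.1, hp.2.1, hp.2.2.1, hp.2.2.2.1, hp.2.2.2.2.neg.max continuousAt_const⟩

end SignedGraphon

/-! ### Hoeffding's inequality and order statistics -/

/-- **Hoeffding's inequality** for weighted sums of independent `[0,1]`-valued variables. -/
theorem measureReal_le_sum_mul_sub_le {ι Ω : Type*} [Fintype ι] [MeasurableSpace Ω]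
    {μ : Measure Ω} [IsProbabilityMeasure μ] {Y : ι → Ω → ℝ} (hind : iIndepFun Y μ)
    (hm : ∀ i, AEMeasurable (Y i) μ) (h01 : ∀ i ω, Y i ω ∈ Set.Icc 0 1) {b : ι → ℝ}
    (hb : ∀ i, |b i| ≤ 2) {N : ℝ} (hN : Fintype.card ι ≤ N) {t : ℝ} (ht : 0 < t) :
    μ.real {ω | t ≤ ∑ i, b i * (Y i ω - μ[Y i])} ≤ Real.exp (-t ^ 2 / (2 * N)) := by
  -- For an empty sum the general bound degenerates to `exp (-t² / 0) = 1`, so this case is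
  -- separate.
  rcases isEmpty_or_nonempty ι with hι | hι
  · have : {ω : Ω | t ≤ ∑ i, b i * (Y i ω - μ[Y i])} = ∅ := by
      ext ω; simpa using ht
    rw [this, measureReal_empty]
    exact (Real.exp_pos _).le
  -- A `[0,1]`-valued variable has parameter `1/4`; the weight multiplies it by `b i ^ 2 ≤ 4`. The
  -- result is rounded up to the common value `1`.
  have hsub : ∀ i, HasSubgaussianMGF (fun ω => b i * (Y i ω - μ[Y i])) 1 μ := fun i => by
    have h2 : b i ^ 2 ≤ 4 := by
      have := sq_le_sq' (by linarith [abs_nonneg (b i)] : -2 ≤ |b i|) (hb i)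
      rw [sq_abs] at this
      linarith
    obtain ⟨c, hc, h⟩ : ∃ c : NNReal, (c : ℝ) ≤ 1 ∧
        HasSubgaussianMGF (fun ω => b i * (Y i ω - μ[Y i])) c μ := by
      refine ⟨_, ?_, (hasSubgaussianMGF_of_mem_Icc (hm i) (ae_of_all _ (h01 i))).const_mul (b i)⟩
      change b i ^ 2 * (((‖(1 : ℝ) - 0‖₊ / 2) ^ 2 : NNReal) : ℝ) ≤ 1
      norm_num
      linarith
    refine ⟨h.integrable_exp_mul, fun s => (h.mgf_le s).trans (Real.exp_le_exp.2 ?_)⟩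
    rw [NNReal.coe_one]
    gcongr
  have hind' : iIndepFun (fun i ω => b i * (Y i ω - μ[Y i])) μ :=
    hind.comp (fun i y => b i * (y - ∫ ω, Y i ω ∂μ)) fun i => by fun_prop
  refine (HasSubgaussianMGF.measure_sum_ge_le_of_iIndepFun hind' (s := Finset.univ)
    (fun i _ => hsub i) ht.le).trans (Real.exp_le_exp.2 ?_)
  have hpos : (0 : ℝ) < Fintype.card ι := by exact_mod_cast Fintype.card_pos
  simp only [Finset.sum_const, Finset.card_univ, nsmul_eq_mul, mul_one, neg_div]
  gcongr
  simpa using hN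

section EmpiricalDistribution

variable {Ω : Type*} [MeasurableSpace Ω] {P : Measure Ω} [IsProbabilityMeasure P]

/-- Hoeffding for the indicators of `U i ≤ q`, of mean `q`. The weights `b = 1` and `b = -1` give
the two tails, and the bound is geometric in `n`, ready for Borel–Cantelli. -/
theorem measureReal_le_empirical_sub_le {n : ℕ} {U : Fin n → Ω → I}
    (hU : ∀ i, HasLaw (U i) volume P) (hind : iIndepFun U P) (q : I) {b : ℝ} (hb : |b| ≤ 2)
    {ε : ℝ} (hε : 0 < ε) (hn : 0 < n) :
    P.real {ω | ε * n ≤ b * (((Finset.univ.filter fun i => U i ω ≤ q).card : ℝ) - n * q)} ≤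
      Real.exp (-(ε ^ 2 / 2)) ^ n := by
  set φ : I → ℝ := (Set.Iic q).indicator fun _ => 1 with hφ
  have hφm : Measurable φ := measurable_const.indicator measurableSet_Iic
  have hE : ∀ i, ∫ ω, φ (U i ω) ∂P = q := fun i => by
    rw [← integral_map (hU i).aemeasurable hφm.aestronglyMeasurable, (hU i).map_eq, hφ,
      integral_indicator_const _ measurableSet_Iic, measureReal_def, unitInterval.volume_Iic,
      ENNReal.toReal_ofReal q.2.1]
    simp
  have hn' : (0 : ℝ) < n := by exact_mod_cast hn
  have h := measureReal_le_sum_mul_sub_le (μ := P) (Y := fun i ω => φ (U i ω))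
    (hind.comp (fun _ => φ) fun _ => hφm) (fun i => hφm.comp_aemeasurable (hU i).aemeasurable)
    (fun i ω => by
      by_cases h : U i ω ≤ q <;> simp [hφ, h]) (b := fun _ => b) (fun _ => hb)
    (N := n) (by simp) (t := ε * n) (by positivity)
  simp only [hE] at h
  refine (measureReal_mono (fun ω hω => ?_)).trans (h.trans_eq ?_)
  · refine le_of_le_of_eq (Set.mem_ofPred_eq ▸ hω) ?_
    rw [← Finset.mul_sum, Finset.sum_sub_distrib]
    simp [hφ, Set.indicator_apply]
  · rw [← Real.exp_nat_mul]
    congr 1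
    field_simp

theorem ae_eventually_empirical_lt {U : (n : ℕ) → Fin n → Ω → I}
    (hU : ∀ n i, HasLaw (U n i) volume P) (hind : ∀ n, iIndepFun (U n) P) (q : I) {b : ℝ}
    (hb : |b| ≤ 2) {ε : ℝ} (hε : 0 < ε) :
    ∀ᵐ ω ∂P, ∀ᶠ n in atTop,
      b * (((Finset.univ.filter fun i => U n i ω ≤ q).card : ℝ) - n * q) < ε * n := by
  have hr : Real.exp (-(ε ^ 2 / 2)) < 1 := Real.exp_lt_one_iff.2 (by have := pow_pos hε 2; linarith)
  have hs := ae_eventually_notMem (μ := P) (s := fun n => {ω | 0 < n ∧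
      ε * n ≤ b * (((Finset.univ.filter fun i => U n i ω ≤ q).card : ℝ) - n * q)}) ?_
  · filter_upwards [hs] with ω hω
    filter_upwards [hω, eventually_gt_atTop 0] with n hn hn0
    by_contra! h
    exact hn ⟨hn0, h⟩
  · refine ne_top_of_le_ne_top (ENNReal.ofReal_ne_top (r := ∑' n, Real.exp (-(ε ^ 2 / 2)) ^ n)) ?_
    rw [ENNReal.ofReal_tsum_of_nonneg (fun n => by positivity)
      (summable_geometric_of_lt_one (Real.exp_pos _).le hr)]
    refine ENNReal.tsum_le_tsum fun n => ?_
    rcases Nat.eq_zero_or_pos n with rfl | hn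
    · simp
    · rw [← ofReal_measureReal]
      refine ENNReal.ofReal_le_ofReal ?_
      refine (measureReal_mono ?_).trans (measureReal_le_empirical_sub_le (hU n) (hind n) q hb hε hn)
      exact fun ω hω => hω.2

/-- The order statistics of i.i.d. uniform variables converge to the uniform quantiles. -/
theorem IsStochasticLatent.ae_latentConverges {X : (n : ℕ) → Ω → Fin n → I}
    (hX : ∀ n, IsStochasticLatent P (X n)) : ∀ᵐ ω ∂P, LatentConverges fun n => X n ω := by
  choose U hU hind hXU using hX
  -- Only countably many levels and accuracies are used, so a single null set suffices.
  have key : ∀ᵐ ω ∂P, ∀ q : ℚ, ∀ hq : (q : ℝ) ∈ I, ∀ k : ℕ, ∀ᶠ n in atTop,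
      |((Finset.univ.filter fun i => U n i ω ≤ (⟨q, hq⟩ : I)).card : ℝ) - n * q|
        < 1 / ((k : ℝ) + 1) * n := by
    refine ae_all_iff.2 fun q => ae_all_iff.2 fun hq => ae_all_iff.2 fun k => ?_
    filter_upwards [ae_eventually_empirical_lt hU hind ⟨q, hq⟩ (b := 1) (by norm_num)
      (ε := 1 / ((k : ℝ) + 1)) (by positivity), ae_eventually_empirical_lt hU hind ⟨q, hq⟩
      (b := -1) (by norm_num) (ε := 1 / ((k : ℝ) + 1)) (by positivity)] with ω h1 h2
    filter_upwards [h1, h2] with n h1 h2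
    exact abs_lt.2 ⟨by linarith, by simpa using h1⟩
  filter_upwards [key] with ω hω
  have hmono : ∀ n, Monotone (X n ω) := fun n => by
    have h := Tuple.monotone_sort fun k => U n k ω
    intro i j hij
    rw [hXU n ω i, hXU n ω j]
    exact h hij
  have hcard : ∀ n (q : I), (Finset.univ.filter fun i => X n ω i ≤ q).card
      = (Finset.univ.filter fun i => U n i ω ≤ q).card := fun n q => by
    refine Finset.card_bij (fun i _ => Tuple.sort (fun k => U n k ω) i) ?_ ?_ ?_
    · intro i hi
      simpa [hXU n ω i] using hi
    · exact fun i _ j _ h => (Tuple.sort fun k => U n k ω).injective h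
    · intro j hj
      refine ⟨(Tuple.sort fun k => U n k ω).symm j, ?_, by simp⟩
      simpa [hXU n ω] using hj
  -- Duality of quantiles and counts: with indices from `0`, the `i`-th order statistic is at most
  -- `q` exactly when more than `i` sample points are.
  have hiff : ∀ n (i : Fin n) (q : I), X n ω i ≤ q ↔
      (i : ℕ) < (Finset.univ.filter fun i => U n i ω ≤ q).card := fun n i q => by
    rw [← hcard]
    exact (Tuple.lt_card_le_iff_apply_le_of_monotone (hmono n)).symm
  intro x hx0 hx1 ε hε
  obtain ⟨q, hq1, hq2⟩ := exists_rat_btwn (max_lt hx0 (sub_lt_self (x : ℝ) hε))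
  obtain ⟨r, hr1, hr2⟩ := exists_rat_btwn (lt_min hx1 (lt_add_of_pos_right (x : ℝ) hε))
  obtain ⟨hq0, hqε⟩ := max_lt_iff.1 hq1
  obtain ⟨hr0, hrε⟩ := lt_min_iff.1 hr2
  have hqI : (q : ℝ) ∈ I := ⟨hq0.le, by linarith⟩
  have hrI : (r : ℝ) ∈ I := ⟨by linarith, hr0.le⟩
  obtain ⟨k, hk⟩ := exists_nat_one_div_lt (sub_pos.2 hq2)
  obtain ⟨l, hl⟩ := exists_nat_one_div_lt (sub_pos.2 hr1)
  filter_upwards [hω q hqI k, hω r hrI l, eventually_gt_atTop 0] with n h1 h2 hn i hi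
  have hn' : (0 : ℝ) < n := by exact_mod_cast hn
  obtain ⟨hi1, hi2⟩ := hi
  rw [div_lt_iff₀ hn'] at hi1
  rw [le_div_iff₀ hn'] at hi2
  have h1' := (abs_lt.1 h1).2
  have h2' := (abs_lt.1 h2).1
  have hk' := mul_lt_mul_of_pos_right hk hn'
  have hl' := mul_lt_mul_of_pos_right hl hn'
  -- With `q < x < r`, the count at `q` is below `n x ≤ i + 1`, while the count at `r` exceeds `n x
  -- > i`; so `X n ω i` lies in `(q, r]`.
  have hlow : ¬ X n ω i ≤ (⟨q, hqI⟩ : I) := by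
    rw [hiff, not_lt, ← Nat.lt_succ_iff]
    have : ((Finset.univ.filter fun i => U n i ω ≤ (⟨q, hqI⟩ : I)).card : ℝ) < (i : ℕ) + 1 := by
      linarith
    exact_mod_cast this
  have hup : X n ω i ≤ (⟨r, hrI⟩ : I) := by
    rw [hiff]
    have : ((i : ℕ) : ℝ) < (Finset.univ.filter fun i => U n i ω ≤ (⟨r, hrI⟩ : I)).card := by
      linarith
    exact_mod_cast this
  have hlow' : (q : ℝ) < X n ω i := not_le.1 hlow
  have hup' : (X n ω i : ℝ) ≤ r := hup
  exact abs_lt.2 ⟨by linarith, by linarith⟩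

end EmpiricalDistribution

/-! ### Concentration of the edge noise -/

/-- Splitting a double sum into off-diagonal pairs and the diagonal. -/
theorem sum_sum_eq_sum_nodePair {n : ℕ} (f : Fin n → Fin n → ℝ) :
    ∑ i, ∑ j, f i j = ∑ p : NodePair n, (f p.1.1 p.1.2 + f p.1.2 p.1.1) + ∑ i, f i i := by
  have h1 : ∀ g : Fin n → Fin n → ℝ, ∑ p : NodePair n, g p.1.1 p.1.2
      = ∑ i, ∑ j, if i < j then g i j else 0 := fun g => by
    rw [← Fintype.sum_prod_type' (f := fun i j => if i < j then g i j else 0),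
      ← Finset.sum_filter]
    exact (Finset.sum_subtype (p := fun p : Fin n × Fin n => p.1 < p.2) _ (by simp)
      fun p => g p.1 p.2).symm
  rw [Finset.sum_add_distrib, h1 f, h1 fun i j => f j i,
    Finset.sum_comm (f := fun i j => if i < j then f j i else 0), ← Finset.sum_add_distrib,
    ← Finset.sum_add_distrib]
  refine Finset.sum_congr rfl fun i _ => ?_
  have h2 : f i i = ∑ j, if i = j then f i j else 0 := by simp
  rw [h2, ← Finset.sum_add_distrib, ← Finset.sum_add_distrib]
  refine Finset.sum_congr rfl fun j _ => ?_
  rcases lt_trichotomy i j with h | h | h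
  · simp [h, h.ne, h.not_gt]
  · simp [h]
  · simp [h, h.ne', h.not_gt]

namespace SignedGraphon

/-- The bilinear form, evaluated at sign vectors `s, t`, of the matrix with zero diagonal and
entries `h (x i) (x j) (η_{ij} - |W (x i) (x j)|)` off the diagonal. -/
noncomputable def edgeNoise (W : SignedGraphon) (h : I → I → ℝ) {n : ℕ} (s t : Fin n → Bool)
    (x : Fin n → I) (η : NodePair n → Bool) : ℝ :=
  ∑ p : NodePair n, (h (x p.1.1) (x p.1.2) *
    (boolSign (s p.1.1) * boolSign (t p.1.2) + boolSign (s p.1.2) * boolSign (t p.1.1))) *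
    ((if η p then 1 else 0) - |W (x p.1.1) (x p.1.2)|)

/-- Hoeffding with at most `n ^ 2` independent edges. Each edge fills two matrix entries, so its
weight is at most `2`. -/
theorem edgeLaw_le_edgeNoise (W : SignedGraphon) {h : I → I → ℝ} (hh : ∀ x y, |h x y| ≤ 1) {n : ℕ}
    (s t : Fin n → Bool) (x : Fin n → I) {c : ℝ} (hc : 0 < c) :
    (W.edgeLaw x).real {η | c ≤ W.edgeNoise h s t x η} ≤ Real.exp (-c ^ 2 / (2 * n ^ 2)) := by
  have : IsProbabilityMeasure (W.edgeLaw x) :=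
    inferInstanceAs (IsProbabilityMeasure (Measure.pi fun p : NodePair n =>
      bernoulliMeasure true false (W.edgeProb (x p.1.1) (x p.1.2))))
  have hm : Measurable fun e : Bool => if e then (1 : ℝ) else 0 := measurable_of_finite _
  have hE : ∀ p : NodePair n, ∫ η, (if η p then (1 : ℝ) else 0) ∂(W.edgeLaw x)
      = |W (x p.1.1) (x p.1.2)| := fun p => by
    rw [edgeLaw, integral_comp_eval (μ := fun p : NodePair n =>
      bernoulliMeasure true false (W.edgeProb (x p.1.1) (x p.1.2)))
      (f := fun e : Bool => if e then (1 : ℝ) else 0) hm.aestronglyMeasurable,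
      integral_bernoulliMeasure]
    simp [edgeProb]
  have hcard : (Fintype.card (NodePair n) : ℝ) ≤ n ^ 2 := by
    have := Fintype.card_subtype_le fun p : Fin n × Fin n => p.1 < p.2
    rw [Fintype.card_prod, Fintype.card_fin] at this
    rw [sq]
    exact_mod_cast this
  have key := measureReal_le_sum_mul_sub_le (μ := W.edgeLaw x)
    (Y := fun (p : NodePair n) (η : NodePair n → Bool) => if η p then (1 : ℝ) else 0)
    (iIndepFun_pi (μ := fun p : NodePair n =>
      bernoulliMeasure true false (W.edgeProb (x p.1.1) (x p.1.2)))
      (X := fun _ e => if e then (1 : ℝ) else 0) fun _ => hm.aemeasurable)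
    (fun p => (hm.comp (measurable_pi_apply p)).aemeasurable)
    (fun p η => by split_ifs <;> simp)
    (b := fun p => h (x p.1.1) (x p.1.2) *
      (boolSign (s p.1.1) * boolSign (t p.1.2) + boolSign (s p.1.2) * boolSign (t p.1.1)))
    (fun p => by
      rw [abs_mul]
      refine (mul_le_of_le_one_left (abs_nonneg _) (hh _ _)).trans ((abs_add_le _ _).trans ?_)
      simp only [abs_mul, abs_boolSign]
      norm_num)
    hcard hc
  simp only [hE] at key
  exact key

theorem measurable_edgeNoise (W : SignedGraphon) {h : I → I → ℝ}
    (hm : Measurable (Function.uncurry h)) {n : ℕ} (s t : Fin n → Bool) :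
    Measurable fun q : (Fin n → I) × (NodePair n → Bool) => W.edgeNoise h s t q.1 q.2 := by
  unfold edgeNoise
  refine Finset.measurable_sum _ fun p _ => ?_
  have hx : Measurable fun q : (Fin n → I) × (NodePair n → Bool) => (q.1 p.1.1, q.1 p.1.2) :=
    ((measurable_pi_apply p.1.1).comp measurable_fst).prodMk
      ((measurable_pi_apply p.1.2).comp measurable_fst)
  have hb : Measurable fun e : Bool => if e then (1 : ℝ) else 0 := measurable_of_finite _
  exact ((hm.comp hx).mul_const _).mul ((hb.comp ((measurable_pi_apply p).comp measurable_snd)).sub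
    (continuous_abs.measurable.comp (W.measurable'.comp hx)))

/-- At the threshold `4 n √n` the Hoeffding bound is `exp (-16 n³ / (2 n²)) = exp (-8 n)`, which
beats the `4 ^ n` pairs of sign vectors. -/
theorem measure_exists_le_edgeNoise {Ω : Type*} [MeasurableSpace Ω] {P : Measure Ω}
    [IsProbabilityMeasure P] (W : SignedGraphon) {h : I → I → ℝ}
    (hm : Measurable (Function.uncurry h)) (hh : ∀ x y, |h x y| ≤ 1) {n : ℕ} (hn : 0 < n)
    {X : Ω → Fin n → I} {η : Ω → NodePair n → Bool}
    (hη : HasCondDistrib η X (W.edgeKernel n) P) :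
    P {ω | ∃ s t, 4 * (n * √n) ≤ W.edgeNoise h s t (X ω) (η ω)} ≤
      ENNReal.ofReal ((4 * Real.exp (-8)) ^ n) := by
  have hn' : (0 : ℝ) < n := by exact_mod_cast hn
  have hX : AEMeasurable X P := hη.aemeasurable_fst
  have := Measure.isProbabilityMeasure_map hX
  have hone : ∀ s t : Fin n → Bool, P {ω | 4 * (n * √n) ≤ W.edgeNoise h s t (X ω) (η ω)} ≤
      ENNReal.ofReal (Real.exp (-8) ^ n) := fun s t => by
    have hS : MeasurableSet {q : (Fin n → I) × (NodePair n → Bool) |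
        4 * (n * √n) ≤ W.edgeNoise h s t q.1 q.2} :=
      measurableSet_le measurable_const (W.measurable_edgeNoise hm s t)
    have e1 : P {ω | 4 * (n * √n) ≤ W.edgeNoise h s t (X ω) (η ω)} =
        P.map (fun ω => (X ω, η ω)) {q | 4 * (n * √n) ≤ W.edgeNoise h s t q.1 q.2} :=
      (Measure.map_apply_of_aemeasurable hη.aemeasurable hS).symm
    -- Disintegration along `X`: the conditional bound is uniform in the latent points, so their law
    -- plays no role.
    rw [e1, hη.map_eq, Measure.compProd_apply hS]
    calc _ ≤ ∫⁻ _, ENNReal.ofReal (Real.exp (-8) ^ n) ∂(P.map X) := by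
          refine lintegral_mono fun x => ?_
          change W.edgeLaw x {η | 4 * (n * √n) ≤ W.edgeNoise h s t x η} ≤ _
          have : IsProbabilityMeasure (W.edgeLaw x) :=
            inferInstanceAs (IsProbabilityMeasure (W.edgeKernel n x))
          rw [← ofReal_measureReal]
          refine ENNReal.ofReal_le_ofReal ((W.edgeLaw_le_edgeNoise hh s t x
            (by positivity)).trans_eq ?_)
          rw [← Real.exp_nat_mul]
          congr 1
          rw [mul_pow, mul_pow, Real.sq_sqrt hn'.le]
          field_simp
          norm_num
      _ = _ := by simp
  calc P {ω | ∃ s t, 4 * (n * √n) ≤ W.edgeNoise h s t (X ω) (η ω)}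
      ≤ P (⋃ q : (Fin n → Bool) × (Fin n → Bool),
          {ω | 4 * (n * √n) ≤ W.edgeNoise h q.1 q.2 (X ω) (η ω)}) :=
        measure_mono fun ω ⟨s, t, hst⟩ => Set.mem_iUnion.2 ⟨(s, t), hst⟩
    _ ≤ ∑ q : (Fin n → Bool) × (Fin n → Bool),
          P {ω | 4 * (n * √n) ≤ W.edgeNoise h q.1 q.2 (X ω) (η ω)} := measure_iUnion_fintype_le _ _
    _ ≤ ∑ _q : (Fin n → Bool) × (Fin n → Bool), ENNReal.ofReal (Real.exp (-8) ^ n) :=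
        Finset.sum_le_sum fun q _ => hone q.1 q.2
    _ = ENNReal.ofReal ((4 * Real.exp (-8)) ^ n) := by
        rw [Finset.sum_const, nsmul_eq_mul, Finset.card_univ, Fintype.card_prod, Fintype.card_fun,
          Fintype.card_bool, Fintype.card_fin, mul_pow, ENNReal.ofReal_mul (by positivity),
          ← mul_pow]
        norm_num

theorem ae_eventually_edgeNoise_lt {Ω : Type*} [MeasurableSpace Ω] {P : Measure Ω}
    [IsProbabilityMeasure P] (W : SignedGraphon) {h : I → I → ℝ}
    (hm : Measurable (Function.uncurry h)) (hh : ∀ x y, |h x y| ≤ 1)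
    {X : (n : ℕ) → Ω → Fin n → I} {η : (n : ℕ) → Ω → NodePair n → Bool}
    (hη : ∀ n, HasCondDistrib (η n) (X n) (W.edgeKernel n) P) :
    ∀ᵐ ω ∂P, ∀ᶠ n : ℕ in atTop, ∀ s t, W.edgeNoise h s t (X n ω) (η n ω) < 4 * (n * √n) := by
  have hr : 4 * Real.exp (-8) < 1 := by
    have h1 : (9 : ℝ) ≤ Real.exp 8 := by linarith [Real.add_one_le_exp (8 : ℝ)]
    rw [Real.exp_neg, ← div_eq_mul_inv, div_lt_one (Real.exp_pos _)]
    linarith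
  have hs := ae_eventually_notMem (μ := P) (s := fun n => {ω | 0 < n ∧
      ∃ s t, 4 * (n * √n) ≤ W.edgeNoise h s t (X n ω) (η n ω)}) ?_
  · filter_upwards [hs] with ω hω
    filter_upwards [hω, eventually_gt_atTop 0] with n hn hn0 s t
    by_contra! hle
    exact hn ⟨hn0, s, t, hle⟩
  · refine ne_top_of_le_ne_top (ENNReal.ofReal_ne_top (r := ∑' n, (4 * Real.exp (-8)) ^ n)) ?_
    rw [ENNReal.ofReal_tsum_of_nonneg (fun n => by positivity)
      (summable_geometric_of_lt_one (by positivity) hr)]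
    refine ENNReal.tsum_le_tsum fun n => ?_
    rcases Nat.eq_zero_or_pos n with rfl | hn
    · simp
    · exact (measure_mono fun ω hω => hω.2).trans (W.measure_exists_le_edgeNoise hm hh hn (hη n))

/-! ### Convergence of the two parts and conclusion -/

/-- Operator norm bound for the difference between an entrywise part of the sampled graph and the
same part of the graphon at the latent variables. -/
theorem norm_T_sub_sampleGraphon_pow_four_le {W V U : SignedGraphon} {h : I → I → ℝ} {φ : ℝ → ℝ}
    (hφ0 : φ 0 = 0) (hφ : ∀ a : ℝ, |a| ≤ 1 → φ a ∈ Set.Icc 0 1)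
    (hV : ∀ x y, V x y = h x y * |W x y|) (hV01 : ∀ x y, V x y ∈ Set.Icc 0 1)
    (hφh : ∀ x y, φ (Real.sign (W x y)) = h x y)
    {n : ℕ} (hn : 0 < n) {G : SignedGraph n} {x : Fin n → I} {η : NodePair n → Bool}
    (hG : ∀ p : NodePair n, G.adj p.1.1 p.1.2
      = Real.sign (W (x p.1.1) (x p.1.2)) * if η p then 1 else 0)
    (hU : ∀ u v, U u v = φ (G.toGraphon u v))
    (hnoise : ∀ s t, W.edgeNoise h s t x η < 4 * (n * √n)) :
    ‖U.T - (SignedGraph.sampleGraphon V x).T‖ ^ 4 ≤ 4 * (√n)⁻¹ + (n : ℝ)⁻¹ := by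
  have hn' : (0 : ℝ) < n := by exact_mod_cast hn
  set d : Fin n → Fin n → ℝ := fun i j => φ (G.adj i j) - V (x i) (x j) with hd
  have hUV : ∀ u v, U u v - SignedGraph.sampleGraphon V x u v = SignedGraph.stepKernel d u v :=
    fun u v => by
      rw [hU]
      change φ (SignedGraph.stepKernel G.adj u v) -
        SignedGraph.stepKernel (fun i j => V (x i) (x j)) u v = _
      rw [SignedGraph.comp_stepKernel _ hφ0, SignedGraph.stepKernel_sub]
  -- Both terms lie in `[0,1]`, which is why the signed parts are handled separately: a difference
  -- of signed entries could reach `2`.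
  have hd1 : ∀ i j, |d i j| ≤ 1 := fun i j => by
    have ha : |G.adj i j| ≤ 1 := by rcases G.entries' i j with h | h | h <;> simp [h]
    have h1 := hφ _ ha
    have h2 := hV01 (x i) (x j)
    exact abs_le.2 ⟨by simp only [hd]; linarith [h1.1, h2.2],
      by simp only [hd]; linarith [h1.2, h2.1]⟩
  have hsymm : ∀ i j, d i j = d j i := fun i j => by
    simp only [hd]
    rw [G.symm' i j, V.symm' (x i) (x j)]
  -- Because `φ` fixes `0` and sends `sign W` to `h`, the sampled entry is `h η`, whereas `V = h
  -- |W|`.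
  have hdp : ∀ p : NodePair n, d p.1.1 p.1.2 = h (x p.1.1) (x p.1.2) *
      ((if η p then 1 else 0) - |W (x p.1.1) (x p.1.2)|) := fun p => by
    simp only [hd]
    rw [hG, hV]
    split_ifs
    · rw [mul_one, hφh]; ring
    · rw [mul_zero, hφ0]; ring
  -- The extra `n` pays for the arbitrary diagonal: `n` entries of size at most `1`, negligible
  -- against `n ^ 2`.
  have key := SignedGraph.norm_T_sub_pow_four_le hUV hd1 (c := 4 * (n * √n) + n) (by positivity)
    fun s t => by
      rw [sum_sum_eq_sum_nodePair]
      refine add_le_add (le_of_eq_of_le ?_ (hnoise s t).le) ?_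
      · refine Finset.sum_congr rfl fun p _ => ?_
        rw [hsymm p.1.2 p.1.1, hdp]
        ring
      · calc _ ≤ ∑ _i : Fin n, (1 : ℝ) := Finset.sum_le_sum fun i _ => (le_abs_self _).trans (by
              rw [abs_mul, abs_mul, abs_boolSign, abs_boolSign, mul_one, mul_one]
              exact hd1 i i)
          _ = n := by simp
  refine key.trans_eq ?_
  have hs : √(n : ℝ) ^ 2 = n := Real.sq_sqrt hn'.le
  have hs0 : 0 < √(n : ℝ) := Real.sqrt_pos.2 hn'
  field_simp
  linear_combination 4 * hs

/-- Convergence in operator norm of an entrywise part of the sampled graphs. -/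
theorem ae_tendsto_norm_T_part {Ω : Type*} [MeasurableSpace Ω] {P : Measure Ω}
    [IsProbabilityMeasure P] {W V : SignedGraphon} {h : I → I → ℝ} {φ : ℝ → ℝ}
    (hm : Measurable (Function.uncurry h)) (hh : ∀ x y, |h x y| ≤ 1)
    (hφ0 : φ 0 = 0) (hφ : ∀ a : ℝ, |a| ≤ 1 → φ a ∈ Set.Icc 0 1)
    (hV : ∀ x y, V x y = h x y * |W x y|) (hV01 : ∀ x y, V x y ∈ Set.Icc 0 1)
    (hφh : ∀ x y, φ (Real.sign (W x y)) = h x y)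
    (hcont : ∀ᵐ p : I × I, (0 : ℝ) < p.1 ∧ (p.1 : ℝ) < 1 ∧ (0 : ℝ) < p.2 ∧ (p.2 : ℝ) < 1 ∧
      ContinuousAt (Function.uncurry V) p)
    {X : (n : ℕ) → Ω → Fin n → I} (hX : ∀ᵐ ω ∂P, LatentConverges fun n => X n ω)
    {G : (n : ℕ) → Ω → SignedGraph n} (hG : ∀ n, W.IsSampledGraph P (X n) (G n))
    {U : (n : ℕ) → Ω → SignedGraphon} (hU : ∀ n ω u v, U n ω u v = φ ((G n ω).toGraphon u v)) :
    ∀ᵐ ω ∂P, Tendsto (fun n => ‖(U n ω).T - V.T‖) atTop (𝓝 0) := by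
  choose η hη hGη using hG
  filter_upwards [hX, W.ae_eventually_edgeNoise_lt hm hh hη] with ω h1 h2
  have hlim : Tendsto (fun n : ℕ => 4 * (√(n : ℝ))⁻¹ + (n : ℝ)⁻¹) atTop (𝓝 0) := by
    have ha := (Real.tendsto_sqrt_atTop.comp
      (tendsto_natCast_atTop_atTop (R := ℝ))).inv_tendsto_atTop
    simpa using (ha.const_mul 4).add tendsto_inv_atTop_nhds_zero_nat
  have h4 : Tendsto (fun n => ‖(U n ω).T - (SignedGraph.sampleGraphon V (X n ω)).T‖ ^ 4) atTop
      (𝓝 0) := by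
    refine squeeze_zero' (Eventually.of_forall fun n => by positivity) ?_ hlim
    filter_upwards [h2, eventually_gt_atTop 0] with n hn hn0
    exact norm_T_sub_sampleGraphon_pow_four_le hφ0 hφ hV hV01 hφh hn0 (hGη n ω) (hU n ω) hn
  have h5 : Tendsto (fun n => ‖(U n ω).T - (SignedGraph.sampleGraphon V (X n ω)).T‖) atTop
      (𝓝 0) := by
    have hsq : ∀ a : ℝ, 0 ≤ a → √(√(a ^ 4)) = a := fun a ha => by
      rw [show a ^ 4 = (a ^ 2) ^ 2 by ring, Real.sqrt_sq (sq_nonneg a), Real.sqrt_sq ha]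
    simpa [hsq _ (norm_nonneg _)] using h4.sqrt.sqrt
  refine squeeze_zero (fun n => norm_nonneg _) (fun n => norm_sub_le_norm_sub_add_norm_sub _
    (SignedGraph.sampleGraphon V (X n ω)).T _) ?_
  simpa using h5.add (tendsto_norm_T_sampleGraphon hcont h1)

theorem T_eq_posPart_sub_negPart (W : SignedGraphon) : W.T = W.posPart.T - W.negPart.T := by
  ext1 f
  refine Lp.ext ?_
  rw [_root_.sub_apply]
  filter_upwards [Lp.coeFn_sub (W.posPart.T f) (W.negPart.T f), W.T_apply_ae f,
    W.posPart.T_apply_ae f, W.negPart.T_apply_ae f] with x h1 h2 h3 h4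
  rw [h1, Pi.sub_apply, h2, h3, h4,
    ← integral_sub (W.posPart.integrable_mul f x) (W.negPart.integrable_mul f x)]
  refine integral_congr_ae (ae_of_all _ fun y => ?_)
  have : W x y = max (W x y) 0 - max (-W x y) 0 := by
    rcases le_total 0 (W x y) with h | h
    · rw [max_eq_left h, max_eq_right (by linarith)]; ring
    · rw [max_eq_right h, max_eq_left (by linarith)]; ring
  change W x y * f y = max (W x y) 0 * f y - max (-W x y) 0 * f y
  rw [← sub_mul, ← this]

end SignedGraphon

theorem proposition2 {Ω : Type*} [MeasurableSpace Ω] (P : Measure Ω) [IsProbabilityMeasure P]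
    (W : SignedGraphon) (hW : W.IsPiecewiseLipschitz)
    (X : (n : ℕ) → Ω → Fin n → I)
    (hX : (∀ n, IsDeterministicLatent (X n)) ∨ (∀ n, IsStochasticLatent P (X n)))
    (G : (n : ℕ) → Ω → SignedGraph n)
    (hG : ∀ n, W.IsSampledGraph P (X n) (G n)) :
    ∀ᵐ ω ∂P,
      Tendsto (fun n => ‖(G n ω).toGraphon.T - W.T‖) atTop (𝓝 0) ∧
      Tendsto (fun n => ‖(G n ω).toGraphon.posPart.T - W.posPart.T‖) atTop (𝓝 0) ∧
      Tendsto (fun n => ‖(G n ω).toGraphon.negPart.T - W.negPart.T‖) atTop (𝓝 0) := by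
  have hlat : ∀ᵐ ω ∂P, LatentConverges fun n => X n ω := by
    rcases hX with h | h
    · exact ae_of_all _ (IsDeterministicLatent.latentConverges h)
    · exact IsStochasticLatent.ae_latentConverges h
  have hpos : ∀ᵐ ω ∂P,
      Tendsto (fun n => ‖(G n ω).toGraphon.posPart.T - W.posPart.T‖) atTop (𝓝 0) := by
    -- Here `h` is the indicator of `W > 0`, so that `W⁺ = h |W|` and `max (sign W) 0 = h`; the
    -- negative part is symmetric.
    refine SignedGraphon.ae_tendsto_norm_T_part (W := W) (φ := fun a => max a 0)
      (h := fun x y => if 0 < W x y then 1 else 0) ?_ ?_ (by simp) ?_ ?_ ?_ ?_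
      (SignedGraphon.ae_continuousAt_posPart hW) hlat hG fun _ _ _ _ => rfl
    · exact Measurable.ite (measurableSet_lt measurable_const W.measurable') measurable_const
        measurable_const
    · intro x y; split_ifs <;> simp
    · exact fun a ha => ⟨le_max_right _ _, max_le (abs_le.1 ha).2 zero_le_one⟩
    · intro x y
      change max (W x y) 0 = _
      split_ifs with h
      · rw [max_eq_left h.le, abs_of_pos h, one_mul]
      · rw [max_eq_right (not_lt.1 h), zero_mul]
    · exact fun x y => ⟨le_max_right _ _, max_le (abs_le.1 (W.abs_le_one' x y)).2 zero_le_one⟩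
    · intro x y
      rcases lt_trichotomy (W x y) 0 with h | h | h
      · simp [Real.sign_of_neg h, h.not_gt]
      · simp [h]
      · simp [Real.sign_of_pos h, h]
  have hneg : ∀ᵐ ω ∂P,
      Tendsto (fun n => ‖(G n ω).toGraphon.negPart.T - W.negPart.T‖) atTop (𝓝 0) := by
    refine SignedGraphon.ae_tendsto_norm_T_part (W := W) (φ := fun a => max (-a) 0)
      (h := fun x y => if W x y < 0 then 1 else 0) ?_ ?_ (by simp) ?_ ?_ ?_ ?_
      (SignedGraphon.ae_continuousAt_negPart hW) hlat hG fun _ _ _ _ => rfl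
    · exact Measurable.ite (measurableSet_lt W.measurable' measurable_const) measurable_const
        measurable_const
    · intro x y; split_ifs <;> simp
    · exact fun a ha => ⟨le_max_right _ _, max_le (by linarith [(abs_le.1 ha).1]) zero_le_one⟩
    · intro x y
      change max (-W x y) 0 = _
      split_ifs with h
      · rw [max_eq_left (by linarith), abs_of_neg h, one_mul]
      · rw [max_eq_right (by linarith), zero_mul]
    · exact fun x y => ⟨le_max_right _ _,
        max_le (by linarith [(abs_le.1 (W.abs_le_one' x y)).1]) zero_le_one⟩
    · intro x y
      rcases lt_trichotomy (W x y) 0 with h | h | h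
      · simp [Real.sign_of_neg h, h]
      · simp [h]
      · simp [Real.sign_of_pos h, h.not_gt]
  filter_upwards [hpos, hneg] with ω h1 h2
  refine ⟨squeeze_zero (fun n => norm_nonneg _) (fun n => ?_) (by simpa using h1.add h2), h1, h2⟩
  rw [(G n ω).toGraphon.T_eq_posPart_sub_negPart, W.T_eq_posPart_sub_negPart, sub_sub_sub_comm]
  exact norm_sub_le _ _
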